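/- An addition chain for a positive integer $n$ is a finite sequence $(a_0,a_1,\ldots,a_r)$ of natural numbers with $a_0=1$, $a_r=n$ such that for every $1\le k\le r$ there are $0\le i,j<k$ (possibly $i=j$) with $a_k=a_i+a_j$; the number $r$ is its length. It is a star chain if for every $1\le k\le r$ there is $0\le i<k$ with $a_k=a_{k-1}+a_i$. For a set $A$ of addition chains, let $\ell^A(n)$ be the least length of a chain for $n$ that belongs to $A$, and let $\nu_2(n)$ be the number of ones in the binary expansion of $n$. The set $A$ is called admissible if for every $n\ge 1$: (1) there is a chain for $n$ in $A$ of length at most $\lfloor\log_2 n\rfloor+\nu_2(n)-1$; and (2) $\ell^A(2n)\le \ell^A(n)+1$. For an admissible set $A$, the $A$-defect of $n\ge 1$ is $\delta^A(n)=\ell^A(n)-\log_2 n$; the number $n$ is $A$-stable if $\ell^A(2^k n)=k+\ell^A(n)$ for all integers $k\ge 0$. Put $$\mathscr{D}^A=\{\delta^A(n): n\ge 1\},\qquad \mathscr{D}^A_{st}=\{\delta^A(n): n\ge 1,\ n \text{ is } A\text{-stable}\}.$$ **Theorem.** For every admissible set $A$ of addition chains, the sets $\mathscr{D}^A$ and $\mathscr{D}^A_{st}$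 are well-ordered subsets of $\mathbb{R}$ (with the usual order), each of order type $\omega^\omega$. The set of all addition chains and the set of star chains are both admissible. In particular, writing $\mathscr{D}^\ell,\mathscr{D}^\ell_{st}$ for the sets obtained when $A$ is the set of all addition chains, and $\mathscr{D}^*,\mathscr{D}^*_{st}$ for those obtained when $A$ is the set of star chains, the four sets $\mathscr{D}^\ell$, $\mathscr{D}^*$, $\mathscr{D}^\ell_{st}$, $\mathscr{D}^*_{st}$ are well-ordered, each of order type $\omega^\omega$. -/

import Mathlib

open scoped Ordinal

/-- An addition chain `(a_0, …, a_r)`: `a_0 = 1`, and every later term is a sum of two (not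
necessarily distinct) earlier terms. `len` is the length `r`. -/
structure AdditionChain where
  len : ℕ
  seq : Fin (len + 1) → ℕ
  seq_zero : seq 0 = 1
  sum_of_earlier : ∀ k : Fin (len + 1), 0 < k → ∃ i j, i < k ∧ j < k ∧ seq k = seq i + seq j

/-- The number `a_r` for which the chain is an addition chain. -/
def AdditionChain.target (c : AdditionChain) : ℕ := c.seq (Fin.last c.len)

/-- The star chains: every term `a_k` with `k ≥ 1` (written here `a_{k+1}`) has the form
`a_{k-1} + a_i` for some `i < k`. -/
def starChains : Set AdditionChain :=
  {c | ∀ k : Fin c.len, ∃ i, i < k.succ ∧ c.seq k.succ = c.seq k.castSucc + c.seq i}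

/-- `ℓ^A(n)`: the least length of a chain for `n` belonging to `A` (when there is one). -/
noncomputable def chainLength (A : Set AdditionChain) (n : ℕ) : ℕ :=
  sInf {r | ∃ c ∈ A, c.target = n ∧ c.len = r}

/-- `ν₂(n)`: the number of ones in the binary expansion of `n`. -/
def binaryOnes (n : ℕ) : ℕ := (Nat.digits 2 n).count 1

/-- A set `A` of addition chains is admissible if every `n ≥ 1` has a chain in `A` of length at
most `⌊log₂ n⌋ + ν₂(n) - 1`, and `ℓ^A(2n) ≤ ℓ^A(n) + 1`. -/
structure IsAdmissible (A : Set AdditionChain) : Prop where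
  exists_short : ∀ n : ℕ, 1 ≤ n →
    ∃ c ∈ A, c.target = n ∧ (c.len : ℤ) ≤ ⌊Real.logb 2 (n : ℝ)⌋ + (binaryOnes n : ℤ) - 1
  length_double : ∀ n : ℕ, 1 ≤ n → chainLength A (2 * n) ≤ chainLength A n + 1

/-- The `A`-defect `ℓ^A(n) - log₂ n`. -/
noncomputable def defect (A : Set AdditionChain) (n : ℕ) : ℝ :=
  (chainLength A n : ℝ) - Real.logb 2 (n : ℝ)

/-- The set of all `A`-defects of positive integers. -/
def defectSet (A : Set AdditionChain) : Set ℝ :=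
  {x | ∃ n : ℕ, 1 ≤ n ∧ defect A n = x}

/-- `m` is `A`-stable if `ℓ^A(2^k m) = k + ℓ^A(m)` for all `k ≥ 0`. -/
def IsStable (A : Set AdditionChain) (m : ℕ) : Prop :=
  ∀ k : ℕ, chainLength A (2 ^ k * m) = k + chainLength A m

/-- The set of `A`-stable defects, that is, of the `A`-defects of the `A`-stable positive
integers. -/
def stableDefectSet (A : Set AdditionChain) : Set ℝ :=
  {x | ∃ n : ℕ, 1 ≤ n ∧ IsStable A n ∧ defect A n = x}

/-- The subset `S` of `ℝ` is well-ordered by the usual order of `ℝ`, and has order type `o`. -/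
def IsWellOrderedOfType (S : Set ℝ) (o : Ordinal.{0}) : Prop :=
  ∃ _ : IsWellOrder S (· < ·), Ordinal.type ((· < ·) : S → S → Prop) = o

/-! Write n = 2^k (2^a + t) with t < 2^a. The binary method and the bound a_r ≤ 2^r give ℓ(n) = k +
a + j with 0 ≤ j ≤ ν₂(t), so the defect is j - log₂(1 + t/2^a): a small natural number plus a point
of `sparseNegLogs`. The fractions with at most m binary ones, in decreasing order, contain a copy of
ω^m and have type below ω^(2m+1).

Upper bound: each non-doubling step costs a fixed amount of defect and at most doubles the bound on
binary ones, so defect ≤ R bounds the number of ones by some K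
(`IsAdmissible.exists_binaryOnes_le`). Hence the defects up to R lie in finitely many translates of
`sparseNegLogs K`; this gives well-ordering, and indivisibility of powers of ω excludes a copy of
ω^(2K+1).

Lower bound: every number becomes stable after multiplication by a power of 2, which leaves 1 +
t/2^a unchanged. So `sparseNegLogs m` is covered by m + 1 translates of the stable defects, and by
indivisibility one of them contains a copy of ω^m. -/

/-- `S` contains an order-isomorphic copy of the ordinal `ω ^ m`. -/
def ContainsOmegaPow {α : Type*} [LinearOrder α] (m : ℕ) (S : Set α) : Prop :=
  ∃ φ : Ordinal.{0} → α, StrictMonoOn φ (Set.Iio (ω ^ m)) ∧ Set.MapsTo φ (Set.Iio (ω ^ m)) S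

/-! ### Copies of ω^m in linear orders. -/

namespace ContainsOmegaPow

variable {α β : Type*} [LinearOrder α] [LinearOrder β] {m : ℕ} {S T : Set α}

lemma mono (h : ContainsOmegaPow m S) (hST : S ⊆ T) : ContainsOmegaPow m T := by
  obtain ⟨φ, h1, h2⟩ := h
  exact ⟨φ, h1, h2.mono_right hST⟩

lemma map {g : α → β} {U : Set β} (h : ContainsOmegaPow m S) (hg : StrictMonoOn g S)
    (hm : Set.MapsTo g S U) : ContainsOmegaPow m U := by
  obtain ⟨φ, h1, h2⟩ := h
  exact ⟨g ∘ φ, hg.comp h1 h2, hm.comp h2⟩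

lemma zero_iff : ContainsOmegaPow 0 S ↔ S.Nonempty := by
  constructor
  · rintro ⟨φ, -, h2⟩
    exact ⟨φ 0, h2 (by simp)⟩
  · rintro ⟨x, hx⟩
    refine ⟨fun _ => x, ?_, fun _ _ => hx⟩
    intro a ha b hb hab
    simp only [pow_zero, Set.mem_Iio, Order.lt_one_iff] at ha hb
    subst ha hb
    exact absurd hab (lt_irrefl _)

lemma omega_block_lt {i : ℕ} {r : Ordinal.{0}} (hr : r < ω ^ m) : ω ^ m * i + r < ω ^ m * (i + 1) := by
  rw [mul_add_one]
  gcongr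

lemma omega_block_lt_pow_succ {i : ℕ} {r : Ordinal.{0}} (hr : r < ω ^ m) :
    ω ^ m * i + r < ω ^ (m + 1) := by
  refine (omega_block_lt hr).trans ?_
  rw [pow_succ]
  have : ((i : Ordinal.{0}) + 1) < ω := by exact_mod_cast Ordinal.natCast_lt_omega0 (i + 1)
  have h0 : (0 : Ordinal.{0}) < ω ^ m := lt_of_le_of_lt zero_le hr
  gcongr

/-- Consecutive copies of `ω ^ m` make up a copy of `ω ^ (m + 1)`. -/
lemma iUnion_of_lt {s : ℕ → Set α} (h : ∀ i, ContainsOmegaPow m (s i))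
    (hs : ∀ i j, i < j → ∀ x ∈ s i, ∀ y ∈ s j, x < y) :
    ContainsOmegaPow (m + 1) (⋃ i, s i) := by
  choose ψ h1 h2 using h
  have hpos : (ω ^ m : Ordinal.{0}) ≠ 0 := pow_ne_zero _ Ordinal.omega0_ne_zero
  -- Division by ω^m: the quotient selects the block, the remainder the place in it.
  have key : ∀ o : Ordinal.{0}, o < ω ^ (m + 1) →
      ∃ i : ℕ, ∃ r, r < ω ^ m ∧ o = ω ^ m * i + r := by
    intro o ho
    have : o / ω ^ m < ω := by
      rwa [← Ordinal.lt_mul_iff_div_lt hpos, ← pow_succ]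
    obtain ⟨i, hi⟩ := Ordinal.lt_omega0.1 this
    exact ⟨i, o % ω ^ m, Ordinal.mod_lt _ hpos, by rw [← hi, Ordinal.div_add_mod]⟩
  choose! i r hr hor using key
  refine ⟨fun o => ψ (i o) (r o), ?_, ?_⟩
  · intro a ha b hb hab
    have ha1 := hor a ha
    have hb1 := hor b hb
    rcases lt_trichotomy (i a) (i b) with hlt | heq | hgt
    · exact hs _ _ hlt _ (h2 _ (hr a ha)) _ (h2 _ (hr b hb))
    · have : r a < r b := by
        rw [ha1, hb1, heq] at hab
        exact lt_of_add_lt_add_left hab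
      simp only [heq]
      exact h1 _ (hr a ha) (hr b hb) this
    · exfalso
      have h3 : b < ω ^ m * ((i b : Ordinal) + 1) := by
        conv_lhs => rw [hb1]
        exact omega_block_lt (hr b hb)
      have h4 : ω ^ m * ((i b : Ordinal) + 1) ≤ a := by
        conv_rhs => rw [ha1]
        refine le_trans ?_ le_self_add
        gcongr
        exact_mod_cast hgt
      exact absurd hab (not_lt.2 (h3.le.trans h4))
  · intro o ho
    exact Set.mem_iUnion.2 ⟨i o, h2 _ (hr o ho)⟩

lemma exists_blocks (h : ContainsOmegaPow (m + 1) S) :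
    ∃ s : ℕ → Set α, (∀ i, ContainsOmegaPow m (s i)) ∧
      (∀ i j, i < j → ∀ x ∈ s i, ∀ y ∈ s j, x < y) ∧ ∀ i, s i ⊆ S := by
  obtain ⟨φ, h1, h2⟩ := h
  refine ⟨fun i => (fun r => φ (ω ^ m * i + r)) '' Set.Iio (ω ^ m), fun i => ?_, ?_, ?_⟩
  · refine ⟨fun r => φ (ω ^ m * i + r), ?_, Set.mapsTo_image _ _⟩
    intro a ha b hb hab
    exact h1 (omega_block_lt_pow_succ ha) (omega_block_lt_pow_succ hb) (by gcongr)
  · rintro i j hij _ ⟨a, ha, rfl⟩ _ ⟨b, hb, rfl⟩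
    refine h1 (omega_block_lt_pow_succ ha) (omega_block_lt_pow_succ hb) ?_
    refine (omega_block_lt ha).trans_le (le_trans ?_ le_self_add)
    gcongr
    exact_mod_cast hij
  · rintro i _ ⟨a, ha, rfl⟩
    exact h2 (omega_block_lt_pow_succ ha)

/-- The ordinals `ω ^ m` are indivisible. -/
lemma of_union (h : ContainsOmegaPow m (S ∪ T)) : ContainsOmegaPow m S ∨ ContainsOmegaPow m T := by
  induction m generalizing S T with
  | zero =>
    simpa only [zero_iff, Set.union_nonempty] using h
  | succ m ih =>
    obtain ⟨s, hs1, hs2, hs3⟩ := h.exists_blocks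
    -- By induction each block has a copy of ω^m in one of the two halves; a half that serves
    -- infinitely many blocks contains ω many copies in succession.
    have aux : ∀ U : Set α, {i | ContainsOmegaPow m (s i ∩ U)}.Infinite →
        ContainsOmegaPow (m + 1) U := by
      intro U hU
      have hmono := Nat.nth_strictMono hU
      refine mono (iUnion_of_lt (s := fun i => s (Nat.nth _ i) ∩ U)
        (fun i => Nat.nth_mem_of_infinite hU i) ?_) (Set.iUnion_subset fun i => Set.inter_subset_right)
      intro i j hij x hx y hy
      exact hs2 _ _ (hmono hij) x hx.1 y hy.1
    have hcover : {i | ContainsOmegaPow m (s i ∩ S)} ∪ {i | ContainsOmegaPow m (s i ∩ T)}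
        = Set.univ := by
      refine Set.eq_univ_of_forall fun i => ih ((hs1 i).mono ?_)
      rw [← Set.inter_union_distrib_left]
      exact Set.subset_inter le_rfl (hs3 i)
    have hinf := hcover ▸ Set.infinite_univ (α := ℕ)
    exact (Set.infinite_union.1 hinf).imp (aux S) (aux T)

lemma of_iUnion_lt {k : ℕ} {s : ℕ → Set α} (h : ContainsOmegaPow m (⋃ j < k, s j)) :
    ∃ j < k, ContainsOmegaPow m (s j) := by
  induction k with
  | zero =>
    obtain ⟨φ, -, h2⟩ := h
    have : φ 0 ∈ (⋃ j < 0, s j) := h2 (by simp [pos_iff_ne_zero])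
    simp at this
  | succ k ih =>
    have : (⋃ j < k + 1, s j) = (⋃ j < k, s j) ∪ s k := Set.biUnion_lt_succ s k
    rw [this] at h
    rcases h.of_union with h | h
    · obtain ⟨j, hj, h⟩ := ih h
      exact ⟨j, by omega, h⟩
    · exact ⟨k, by omega, h⟩

/-- A strictly increasing ordinal-valued map on an initial segment of the ordinals satisfies o ≤ g
(φ o); at o = τ this contradicts the bound. -/
lemma not_of_bounded {g : α → Ordinal.{0}} (hg : StrictMonoOn g S) {τ : Ordinal.{0}}
    (hτ : τ < ω ^ m) (hb : ∀ x ∈ S, g x < τ) : ¬ ContainsOmegaPow m S := by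
  rintro ⟨φ, h1, h2⟩
  have hmono := hg.comp h1 h2
  have hle : ∀ o : Ordinal.{0}, o < ω ^ m → o ≤ g (φ o) := by
    intro o
    induction o using WellFoundedLT.induction with
    | ind o ih =>
      intro ho
      by_contra! hlt
      have h3 := ih _ hlt (hlt.trans ho)
      have h4 := hmono (hlt.trans ho) ho hlt
      exact absurd h4 (not_lt.2 h3)
  exact absurd (hb _ (h2 hτ)) (not_lt.2 (hle τ hτ))

end ContainsOmegaPow

/-! ### A criterion for order type ω^ω. -/

lemma exists_lt_omega_pow {τ : Ordinal.{0}} (h : τ < ω ^ ω) : ∃ m : ℕ, τ < ω ^ m := by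
  rw [Ordinal.lt_opow_of_isSuccLimit Ordinal.omega0_ne_zero Ordinal.isSuccLimit_omega0] at h
  obtain ⟨c, hc, h⟩ := h
  obtain ⟨m, rfl⟩ := Ordinal.lt_omega0.1 hc
  exact ⟨m, by simpa using h⟩

/-- If the type exceeded ω^ω, the element in position ω^ω would have copies of every ω^m below it.
If it were smaller, it would be below some ω^m, leaving no room for a copy of ω^m. -/
lemma isWellOrderedOfType_omega_opow_omega {S : Set ℝ} (hwf : S.IsWF)
    (hupper : ∀ x ∈ S, ∃ m, ¬ ContainsOmegaPow m (S ∩ Set.Iio x))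
    (hlower : ∀ m, ContainsOmegaPow m S) : IsWellOrderedOfType S (ω ^ ω) := by
  have hwo : IsWellOrder S (· < ·) := { wf := hwf }
  refine ⟨hwo, le_antisymm ?_ ?_⟩
  · by_contra! hlt
    -- Enumeration of S by position; the value beyond the order type is arbitrary.
    let e : Ordinal.{0} → S := fun o =>
      if h : o < Ordinal.type ((· < ·) : S → S → Prop) then Ordinal.enum (· < ·) ⟨o, h⟩
      else Ordinal.enum (· < ·) ⟨_, hlt⟩
    have he : StrictMonoOn e (Set.Iio (Ordinal.type ((· < ·) : S → S → Prop))) := by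
      intro a ha b hb hab
      simp only [e, dif_pos (Set.mem_Iio.1 ha), dif_pos (Set.mem_Iio.1 hb)]
      exact (Ordinal.enum_lt_enum (r := ((· < ·) : S → S → Prop))).2 hab
    obtain ⟨m, hm⟩ := hupper (e (ω ^ ω)) (e (ω ^ ω)).2
    have hmω : (ω ^ m : Ordinal.{0}) < ω ^ ω := by
      rw [← Ordinal.opow_natCast]
      exact (Ordinal.opow_lt_opow_iff_right Ordinal.one_lt_omega0).2 (Ordinal.natCast_lt_omega0 m)
    refine hm ⟨fun o => e o, ?_, ?_⟩
    · intro a ha b hb hab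
      exact he ((ha.trans hmω).trans hlt) ((hb.trans hmω).trans hlt) hab
    · intro a ha
      exact ⟨(e a).2, he ((ha.trans hmω).trans hlt) hlt (ha.trans hmω)⟩
  · by_contra! hlt
    obtain ⟨m, hm⟩ := exists_lt_omega_pow hlt
    have hu : ContainsOmegaPow m (Set.univ : Set S) := by
      obtain ⟨φ, h1, h2⟩ := hlower m
      have h0 : (0 : Ordinal.{0}) < ω ^ m := lt_of_le_of_lt zero_le hm
      classical
      refine ⟨fun o => if h : o < ω ^ m then ⟨φ o, h2 h⟩ else ⟨φ 0, h2 h0⟩, ?_, fun _ _ => trivial⟩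
      intro a ha b hb hab
      simp only [dif_pos (Set.mem_Iio.1 ha), dif_pos (Set.mem_Iio.1 hb)]
      exact h1 ha hb hab
    refine ContainsOmegaPow.not_of_bounded
      (g := Ordinal.typein ((· < ·) : S → S → Prop)) ?_ hm (fun x _ => Ordinal.typein_lt_type _ x) hu
    intro a _ b _ hab
    exact (Ordinal.typein_lt_typein (· < ·)).2 hab

/-! ### Binary digit sums. -/

lemma binaryOnes_zero : binaryOnes 0 = 0 := by simp [binaryOnes]

lemma binaryOnes_two_mul (n : ℕ) : binaryOnes (2 * n) = binaryOnes n := by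
  rcases Nat.eq_zero_or_pos n with rfl | hn
  · simp
  · have := Nat.digits_add_two_add_one 0 (2 * n - 1)
    have h : 2 * n - 1 + 1 = 2 * n := by omega
    rw [h] at this
    simp [binaryOnes, this]

lemma binaryOnes_two_mul_add_one (n : ℕ) : binaryOnes (2 * n + 1) = binaryOnes n + 1 := by
  have := Nat.digits_add_two_add_one 0 (2 * n)
  have h : (2 * n + 1) / 2 = n := by omega
  simp only [zero_add, h] at this
  rw [binaryOnes, this]
  simp [binaryOnes, Nat.add_mod]

lemma binaryOnes_succ_le (n : ℕ) : binaryOnes (n + 1) ≤ binaryOnes n + 1 := by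
  induction n using Nat.strong_induction_on with
  | _ n ih =>
    obtain ⟨k, rfl | rfl⟩ := Nat.even_or_odd' n
    · rw [binaryOnes_two_mul_add_one, binaryOnes_two_mul]
    · have h := ih k (by omega)
      rw [show 2 * k + 1 + 1 = 2 * (k + 1) by ring, binaryOnes_two_mul, binaryOnes_two_mul_add_one]
      omega

lemma binaryOnes_add_le (m n : ℕ) : binaryOnes (m + n) ≤ binaryOnes m + binaryOnes n := by
  induction m using Nat.strong_induction_on generalizing n with
  | _ m ih =>
    rcases Nat.eq_zero_or_pos m with rfl | hm
    · simp
    obtain ⟨a, rfl | rfl⟩ := Nat.even_or_odd' m <;> obtain ⟨b, rfl | rfl⟩ := Nat.even_or_odd' n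
    · have h := ih a (by omega) b
      rw [← mul_add]
      simpa only [binaryOnes_two_mul] using h
    · have h := ih a (by omega) b
      rw [← add_assoc, ← mul_add]
      simp only [binaryOnes_two_mul, binaryOnes_two_mul_add_one]
      omega
    · have h := ih a (by omega) b
      rw [add_right_comm, ← mul_add]
      simp only [binaryOnes_two_mul, binaryOnes_two_mul_add_one]
      omega
    · have h := ih a (by omega) b
      have h' := binaryOnes_succ_le (a + b)
      rw [show 2 * a + 1 + (2 * b + 1) = 2 * (a + b + 1) by ring]
      simp only [binaryOnes_two_mul, binaryOnes_two_mul_add_one]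
      omega

lemma binaryOnes_two_pow_add {a t : ℕ} (h : t < 2 ^ a) :
    binaryOnes (2 ^ a + t) = binaryOnes t + 1 := by
  induction a generalizing t with
  | zero =>
    obtain rfl : t = 0 := by simpa using h
    simpa [binaryOnes_zero] using binaryOnes_two_mul_add_one 0
  | succ a ih =>
    rw [pow_succ'] at h ⊢
    obtain ⟨u, rfl | rfl⟩ := Nat.even_or_odd' t
    · rw [← mul_add]
      simp only [binaryOnes_two_mul]
      exact ih (by omega)
    · rw [← add_assoc, ← mul_add]
      simp only [binaryOnes_two_mul_add_one]
      rw [ih (by omega)]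

/-! ### Sparse binary fractions and their logarithms. -/

/-- The real numbers in `[0, 1)` with a finite binary expansion that has at most `m` ones. -/
def sparseFractions (m : ℕ) : Set ℝ :=
  {y | ∃ a t : ℕ, t < 2 ^ a ∧ binaryOnes t ≤ m ∧ y = (t : ℝ) / 2 ^ a}

lemma zero_mem_sparseFractions (m : ℕ) : (0 : ℝ) ∈ sparseFractions m :=
  ⟨0, 0, by simp, by simp [binaryOnes_zero], by simp⟩

lemma sparseFractions_subset_Ico (m : ℕ) : sparseFractions m ⊆ Set.Ico 0 1 := by
  rintro _ ⟨a, t, h, -, rfl⟩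
  refine ⟨by positivity, ?_⟩
  rw [div_lt_one (by positivity)]
  exact_mod_cast h

lemma exists_two_pow_add {n : ℕ} (hn : n ≠ 0) :
    ∃ t, t < 2 ^ Nat.log 2 n ∧ n = 2 ^ Nat.log 2 n + t := by
  have h1 := Nat.pow_log_le_self 2 hn
  have h2 := Nat.lt_pow_succ_log_self (b := 2) one_lt_two n
  rw [pow_succ] at h2
  exact ⟨n - 2 ^ Nat.log 2 n, by omega, by omega⟩

lemma binaryOnes_pos {n : ℕ} (hn : n ≠ 0) : 0 < binaryOnes n := by
  obtain ⟨t, ht, h⟩ := exists_two_pow_add hn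
  rw [h, binaryOnes_two_pow_add ht]
  omega

/-- Splitting off the leading one: b counts the zeros between the point and that digit, and z is
what follows it. -/
lemma succ_sparseFractions_cases {m : ℕ} {y : ℝ} (hy : y ∈ sparseFractions (m + 1)) :
    y = 0 ∨ ∃ (b : ℕ) (z : ℝ), z ∈ sparseFractions m ∧ y = (1 + z) / 2 ^ (b + 1) := by
  obtain ⟨a, t, hta, hm, rfl⟩ := hy
  rcases eq_or_ne t 0 with rfl | ht
  · simp
  right
  obtain ⟨u, hu, htu⟩ := exists_two_pow_add ht
  have hlog : Nat.log 2 t < a := Nat.log_lt_of_lt_pow ht hta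
  obtain ⟨b, hb⟩ := Nat.exists_eq_add_of_lt hlog
  set c := Nat.log 2 t
  refine ⟨b, u / 2 ^ c, ⟨c, u, hu, ?_, rfl⟩, ?_⟩
  · rw [htu, binaryOnes_two_pow_add hu] at hm
    omega
  · have h' : (t : ℝ) = 2 ^ c + u := by exact_mod_cast htu
    rw [h', hb, add_assoc, pow_add]
    field_simp

lemma mem_succ_sparseFractions {m : ℕ} {z : ℝ} (hz : z ∈ sparseFractions m) (b : ℕ) :
    (1 + z) / 2 ^ (b + 1) ∈ sparseFractions (m + 1) := by
  obtain ⟨c, u, hu, hm, rfl⟩ := hz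
  refine ⟨c + (b + 1), 2 ^ c + u, ?_, ?_, ?_⟩
  · calc 2 ^ c + u < 2 ^ c * 2 := by omega
      _ ≤ 2 ^ c * 2 ^ (b + 1) := by gcongr; exact Nat.le_self_pow (by omega) 2
      _ = _ := (pow_add _ _ _).symm
  · rw [binaryOnes_two_pow_add hu]
    omega
  · push_cast
    rw [pow_add]
    field_simp
    ring

lemma one_add_div_two_pow_lt {b c : ℕ} {y z : ℝ} (hbc : b < c) (hy : 0 ≤ y) (hz : z < 1) :
    (1 + z) / 2 ^ (c + 1) < (1 + y) / 2 ^ (b + 1) := by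
  have h1 : (2 : ℝ) ^ (b + 1) * 2 ≤ 2 ^ (c + 1) := by
    rw [← pow_succ]
    exact pow_le_pow_right₀ one_le_two (by omega)
  have h2 : (0 : ℝ) < 2 ^ (b + 1) := by positivity
  rw [div_lt_div_iff₀ (by positivity) h2]
  nlinarith

/-- Sparse fractions in decreasing order contain a copy of `ω ^ m`. -/
lemma containsOmegaPow_neg_sparseFractions (m : ℕ) :
    ContainsOmegaPow m {x : ℝ | -x ∈ sparseFractions m} := by
  induction m with
  | zero => exact ContainsOmegaPow.zero_iff.2 ⟨0, by simpa using zero_mem_sparseFractions 0⟩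
  | succ m ih =>
    refine (ContainsOmegaPow.iUnion_of_lt
      (s := fun b => (fun x : ℝ => -((1 + -x) / 2 ^ (b + 1))) '' {x : ℝ | -x ∈ sparseFractions m})
      (fun b => ih.map ?_ (Set.mapsTo_image _ _)) ?_).mono ?_
    · intro x _ y _ hxy
      dsimp only
      gcongr
    · rintro i j hij _ ⟨x, hx, rfl⟩ _ ⟨y, hy, rfl⟩
      exact neg_lt_neg (one_add_div_two_pow_lt hij (sparseFractions_subset_Ico m hx).1
        (sparseFractions_subset_Ico m hy).2)
    · refine Set.iUnion_subset fun b => ?_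
      rintro _ ⟨x, hx, rfl⟩
      simpa only [Set.mem_ofPred_eq, neg_neg] using mem_succ_sparseFractions hx b

/-- A ranking of the sparse fractions, in decreasing order, by ordinals below `ω ^ ω`. -/
lemma exists_rank_sparseFractions (m : ℕ) : ∃ G : ℝ → Ordinal.{0},
    StrictAntiOn G (sparseFractions m) ∧ ∀ y ∈ sparseFractions m, G y < ω ^ (2 * m) := by
  induction m with
  | zero =>
    have h0 : ∀ y ∈ sparseFractions 0, y = 0 := by
      rintro _ ⟨a, t, -, ht, rfl⟩
      have : t = 0 := by
        by_contra h
        have := binaryOnes_pos h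
        omega
      simp [this]
    refine ⟨fun _ => 0, ?_, by simp⟩
    intro x hx y hy hxy
    rw [h0 x hx, h0 y hy] at hxy
    exact absurd hxy (lt_irrefl _)
  | succ m ih =>
    obtain ⟨G, hG, hGlt⟩ := ih
    have hcases := fun y (hy : y ∈ sparseFractions (m + 1)) (h0 : y ≠ 0) =>
      (succ_sparseFractions_cases hy).resolve_left h0
    choose! b z hz hyz using hcases
    have hlt : ∀ y ∈ sparseFractions (m + 1), y ≠ 0 →
        ω ^ (2 * m) * (b y) + G (z y) < ω ^ (2 * m + 1) := fun y hy h0 =>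
      ContainsOmegaPow.omega_block_lt_pow_succ (hGlt _ (hz y hy h0))
    -- More leading zeros means a smaller fraction, hence a later block. The fraction 0 comes after
    -- all blocks, at rank ω^(2m+1); the exponent 2(m+1) leaves room for this last point.
    refine ⟨fun y => if y = 0 then ω ^ (2 * m + 1) else ω ^ (2 * m) * (b y) + G (z y), ?_, ?_⟩
    · intro x hx y hy hxy
      have hx0 := (sparseFractions_subset_Ico _ hx).1
      have hy0 : y ≠ 0 := (hx0.trans_lt hxy).ne'
      rcases eq_or_ne x 0 with rfl | hx0
      · simpa [hy0] using hlt y hy hy0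
      simp only [hx0, hy0, if_false]
      have hxz := hyz x hx hx0
      have hyz := hyz y hy hy0
      have hIx := sparseFractions_subset_Ico _ (hz x hx hx0)
      have hIy := sparseFractions_subset_Ico _ (hz y hy hy0)
      rcases lt_trichotomy (b x) (b y) with h | h | h
      · exfalso
        have := one_add_div_two_pow_lt h hIx.1 hIy.2
        rw [← hxz, ← hyz] at this
        exact lt_asymm this hxy
      · rw [h]
        have : z x < z y := by
          rw [hxz, hyz, h, div_lt_div_iff_of_pos_right (by positivity)] at hxy
          linarith
        have := hG (hz x hx hx0) (hz y hy hy0) this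
        gcongr
      · refine (ContainsOmegaPow.omega_block_lt (hGlt _ (hz y hy hy0))).trans_le
          (le_trans ?_ le_self_add)
        gcongr
        exact_mod_cast h
    · have hpow : (ω ^ (2 * m + 1) : Ordinal.{0}) < ω ^ (2 * (m + 1)) :=
        pow_lt_pow_right₀ Ordinal.one_lt_omega0 (by omega)
      intro y hy
      dsimp only
      split_ifs with h0
      · exact hpow
      · exact (hlt y hy h0).trans hpow

/-- The values of `-log₂` at the numbers in `[1, 2)` with at most `m` ones after the point. -/
def sparseNegLogs (m : ℕ) : Set ℝ := (fun y => -Real.logb 2 (1 + y)) '' sparseFractions m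

lemma neg_logb_one_add_lt {x y : ℝ} (hx : 0 ≤ x) (hxy : x < y) :
    -Real.logb 2 (1 + y) < -Real.logb 2 (1 + x) :=
  neg_lt_neg (Real.logb_lt_logb one_lt_two (by linarith) (by linarith))

lemma containsOmegaPow_sparseNegLogs (m : ℕ) : ContainsOmegaPow m (sparseNegLogs m) := by
  refine (containsOmegaPow_neg_sparseFractions m).map (g := fun x => -Real.logb 2 (1 + -x)) ?_ ?_
  · intro x _ y hy hxy
    exact neg_logb_one_add_lt (sparseFractions_subset_Ico _ hy).1 (neg_lt_neg hxy)
  · exact fun x hx => ⟨-x, hx, rfl⟩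

lemma exists_rank_sparseNegLogs (m : ℕ) : ∃ G : ℝ → Ordinal.{0},
    StrictMonoOn G (sparseNegLogs m) ∧ ∀ x ∈ sparseNegLogs m, G x < ω ^ (2 * m) := by
  obtain ⟨G, hG, hlt⟩ := exists_rank_sparseFractions m
  have hinv : ∀ y ∈ sparseFractions m, (2 : ℝ) ^ (- -Real.logb 2 (1 + y)) - 1 = y := by
    intro y hy
    have := (sparseFractions_subset_Ico m hy).1
    rw [neg_neg, Real.rpow_logb (by norm_num) (by norm_num) (by linarith)]
    ring
  -- The map x ↦ 2^(-x) - 1 inverts y ↦ -log₂(1 + y).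
  refine ⟨fun x => G ((2 : ℝ) ^ (-x) - 1), ?_, ?_⟩
  · rintro _ ⟨x, hx, rfl⟩ _ ⟨y, hy, rfl⟩ hxy
    dsimp only
    rw [hinv x hx, hinv y hy]
    refine hG hy hx ?_
    by_contra! hle
    rcases hle.eq_or_lt with rfl | h
    · exact lt_irrefl _ hxy
    · exact lt_asymm hxy (neg_logb_one_add_lt (sparseFractions_subset_Ico _ hx).1 h)
  · rintro _ ⟨y, hy, rfl⟩
    dsimp only
    rw [hinv y hy]
    exact hlt y hy

lemma not_containsOmegaPow_sparseNegLogs (m : ℕ) :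
    ¬ ContainsOmegaPow (2 * m + 1) (sparseNegLogs m) := by
  obtain ⟨G, hG, hlt⟩ := exists_rank_sparseNegLogs m
  exact ContainsOmegaPow.not_of_bounded hG
    (pow_lt_pow_right₀ Ordinal.one_lt_omega0 (Nat.lt_succ_self _)) hlt

lemma isWF_sparseNegLogs (m : ℕ) : (sparseNegLogs m).IsWF := by
  obtain ⟨G, hG, -⟩ := exists_rank_sparseNegLogs m
  have : WellFounded (fun a b : sparseNegLogs m => (a : ℝ) < b) :=
    Subrelation.wf (fun {a b} hab => hG a.2 b.2 hab)
      (InvImage.wf (fun a : sparseNegLogs m => G a) wellFounded_lt)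
  exact this

lemma logb_two_pow_mul_add (k a t : ℕ) :
    Real.logb 2 (2 ^ k * (2 ^ a + t) : ℕ) = k + a + Real.logb 2 (1 + t / 2 ^ a) := by
  have h : ((2 ^ k * (2 ^ a + t) : ℕ) : ℝ) = 2 ^ (k + a) * (1 + t / 2 ^ a) := by
    push_cast
    rw [pow_add]
    field_simp
  have hpos : (0 : ℝ) < 1 + t / 2 ^ a := by positivity
  rw [h, Real.logb_mul (by positivity) hpos.ne', Real.logb_pow]
  simp

/-! ### Growth of addition chains. -/

namespace AdditionChain

/-- The chain `(1)` of length `0`. -/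
def one : AdditionChain where
  len := 0
  seq _ := 1
  seq_zero := rfl
  sum_of_earlier k hk := absurd hk (by omega)

/-- The chain continued by the sum of its last term and its `i`-th term. -/
def append (c : AdditionChain) (i : Fin (c.len + 1)) : AdditionChain where
  len := c.len + 1
  seq := Fin.snoc (α := fun _ => ℕ) c.seq (c.target + c.seq i)
  seq_zero := by
    rw [← Fin.castSucc_zero, Fin.snoc_castSucc, c.seq_zero]
  sum_of_earlier k hk := by
    induction k using Fin.lastCases with
    | last =>
      exact ⟨(Fin.last c.len).castSucc, i.castSucc, Fin.castSucc_lt_last _, Fin.castSucc_lt_last _, by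
        simp only [Fin.snoc_last, Fin.snoc_castSucc, target]⟩
    | cast k =>
      obtain ⟨a, b, ha, hb, h⟩ := c.sum_of_earlier k hk
      exact ⟨a.castSucc, b.castSucc, ha, hb, by simpa only [Fin.snoc_castSucc] using h⟩

lemma append_len (c : AdditionChain) (i : Fin (c.len + 1)) : (c.append i).len = c.len + 1 := rfl

lemma append_target (c : AdditionChain) (i : Fin (c.len + 1)) :
    (c.append i).target = c.target + c.seq i :=
  Fin.snoc_last (α := fun _ => ℕ) _ _

lemma append_mem_starChains {c : AdditionChain} (hc : c ∈ starChains) (i : Fin (c.len + 1)) :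
    c.append i ∈ starChains := by
  intro (k : Fin (c.len + 1))
  induction k using Fin.lastCases with
  | last =>
    refine ⟨i.castSucc, Fin.castSucc_lt_last _, ?_⟩
    change Fin.snoc (α := fun _ => ℕ) c.seq _ (Fin.last _) = Fin.snoc (α := fun _ => ℕ) c.seq _
      (Fin.castSucc (Fin.last _)) + Fin.snoc (α := fun _ => ℕ) c.seq _ (Fin.castSucc i)
    simp only [Fin.snoc_last, Fin.snoc_castSucc, target]
  | cast k =>
    obtain ⟨j, hj, h⟩ := hc k
    refine ⟨j.castSucc, hj, ?_⟩
    change Fin.snoc (α := fun _ => ℕ) c.seq _ (Fin.castSucc (Fin.succ k)) =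
      Fin.snoc (α := fun _ => ℕ) c.seq _ (Fin.castSucc (Fin.castSucc k)) +
        Fin.snoc (α := fun _ => ℕ) c.seq _ (Fin.castSucc j)
    simpa only [Fin.snoc_castSucc] using h

/-- Along a chain, `M + (2 / 3) M'`, where `M` is the largest term and `M'` bounds the other ones,
grows by a factor of at most `2` at a doubling of the largest term, and at most `5 / 3` otherwise,
while only the latter steps can increase the numbers of binary ones. -/
lemma exists_growth_bound (c : AdditionChain) (k : ℕ) (hk : k ≤ c.len) :
    ∃ (d f : ℕ) (M M' : ℝ), d + f = k ∧ M' ≤ M ∧ M ≤ 2 * M' ∧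
      M + 2 / 3 * M' ≤ 2 ^ d * (5 / 3) ^ f * (4 / 3) ∧
      ∀ i : Fin (c.len + 1), i.val ≤ k →
        ((c.seq i : ℝ) = M ∨ (c.seq i : ℝ) ≤ M') ∧ binaryOnes (c.seq i) ≤ 2 ^ f := by
  induction k with
  | zero =>
    -- With no second term yet, M' = 1/2 is the least value allowed by M ≤ 2M'; it produces the
    -- constant 4/3.
    refine ⟨0, 0, 1, 1 / 2, rfl, by norm_num, by norm_num, by norm_num, fun i hi => ?_⟩
    obtain rfl : i = 0 := Fin.ext (by simpa using hi)
    have := binaryOnes_two_pow_add (a := 0) (t := 0) (by simp)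
    simp_all [c.seq_zero, binaryOnes_zero]
  | succ k ih =>
    obtain ⟨d, f, M, M', hdf, h1, h2, h3, h4⟩ := ih (by omega)
    obtain ⟨a, b, ha, hb, hab⟩ := c.sum_of_earlier ⟨k + 1, by omega⟩ (by simp [Fin.lt_def])
    have ha' := h4 a (by simp [Fin.lt_def] at ha; omega)
    have hb' := h4 b (by simp [Fin.lt_def] at hb; omega)
    have hold : ∀ i : Fin (c.len + 1), i.val ≤ k → (c.seq i : ℝ) ≤ M := fun i hi =>
      (h4 i hi).1.elim le_of_eq fun h => h.trans h1
    have hle : ∀ i : Fin (c.len + 1), i.val ≤ k + 1 →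
        i.val ≤ k ∨ c.seq i = c.seq a + c.seq b := by
      intro i hi
      rcases hi.eq_or_lt with h | h
      · right
        rw [← hab]
        congr 1
        exact Fin.ext h
      · left; omega
    by_cases hM : (c.seq a : ℝ) = M ∧ (c.seq b : ℝ) = M
    -- Here 2M + (2/3)M ≤ 2(M + (2/3)M') is exactly M ≤ 2M'.
    · refine ⟨d + 1, f, 2 * M, M, by omega, by linarith, le_rfl, ?_, fun i hi => ?_⟩
      · rw [pow_succ]
        linarith
      · rcases hle i hi with h | h
        · exact ⟨Or.inr (hold i h), (h4 i h).2⟩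
        · have : c.seq a = c.seq b := by exact_mod_cast hM.1.trans hM.2.symm
          refine ⟨Or.inl ?_, ?_⟩
          · rw [h]
            push_cast
            linarith
          · rw [h, ← this, ← two_mul, binaryOnes_two_mul]
            exact ha'.2
    · have hsum : (c.seq a : ℝ) + c.seq b ≤ M + M' := by
        rcases ha'.1 with h5 | h5 <;> rcases hb'.1 with h6 | h6
        · exact absurd ⟨h5, h6⟩ hM
        all_goals linarith
      -- The new maximum is at most M + M', and (M + M') + (2/3)M ≤ (5/3)(M + (2/3)M'). The maximum
      -- also covers new terms that do not exceed M.
      refine ⟨d, f + 1, max (c.seq a + c.seq b) M, M, by omega, le_max_right _ _,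
        max_le (by linarith) (by linarith), ?_, fun i hi => ?_⟩
      · have : max ((c.seq a : ℝ) + c.seq b) M ≤ M + M' := max_le hsum (by linarith)
        rw [pow_succ]
        linarith
      · rcases hle i hi with h | h
        · refine ⟨Or.inr (hold i h), (h4 i h).2.trans ?_⟩
          exact Nat.pow_le_pow_right two_pos (Nat.le_succ f)
        · constructor
          · rw [h]
            push_cast
            rcases le_total M ((c.seq a : ℝ) + c.seq b) with h | h
            · exact Or.inl (max_eq_left h).symm
            · exact Or.inr h
          · rw [h, pow_succ]
            have := binaryOnes_add_le (c.seq a) (c.seq b)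
            omega

/-- Each of the f non-doubling steps loses a factor 5/6 against perfect doubling. -/
lemma exists_target_bound (c : AdditionChain) : ∃ f : ℕ, binaryOnes c.target ≤ 2 ^ f ∧
    (c.target : ℝ) ≤ 2 ^ c.len * (5 / 6) ^ f * (4 / 3) := by
  obtain ⟨d, f, M, M', hdf, h1, h2, h3, h4⟩ := c.exists_growth_bound c.len le_rfl
  obtain ⟨h5, h6⟩ := h4 (Fin.last _) le_rfl
  refine ⟨f, h6, ?_⟩
  have h7 : (c.target : ℝ) ≤ M := h5.elim le_of_eq fun h => h.trans h1
  have h8 : (2 : ℝ) ^ c.len * (5 / 6) ^ f = 2 ^ d * (5 / 3) ^ f := by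
    rw [← hdf, pow_add, mul_assoc, ← mul_pow]
    norm_num
  rw [h8]
  linarith

lemma target_le_two_pow (c : AdditionChain) : c.target ≤ 2 ^ c.len := by
  have h : ∀ k, ∀ hk : k < c.len + 1, c.seq ⟨k, hk⟩ ≤ 2 ^ k := by
    intro k
    induction k using Nat.strong_induction_on with
    | _ k ih =>
      intro hk
      rcases Nat.eq_zero_or_pos k with rfl | hpos
      · exact c.seq_zero.le
      · obtain ⟨a, b, ha, hb, hab⟩ := c.sum_of_earlier ⟨k, hk⟩ hpos
        have h1 := (ih a ha a.2).trans (Nat.pow_le_pow_right two_pos (Nat.le_sub_one_of_lt ha))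
        have h2 := (ih b hb b.2).trans (Nat.pow_le_pow_right two_pos (Nat.le_sub_one_of_lt hb))
        have h3 : 2 ^ (k - 1) * 2 = 2 ^ k := pow_sub_one_mul hpos.ne' 2
        rw [hab, ← h3, mul_two]
        exact add_le_add h1 h2
  exact h _ _

end AdditionChain

/-! ### Admissible sets and chain lengths. -/

lemma floor_logb_natCast_eq (n : ℕ) : ⌊Real.logb 2 (n : ℝ)⌋ = Nat.log 2 n := by
  have := Real.floor_logb_natCast (b := 2) (r := n) n.cast_nonneg
  rw [Int.log_natCast] at this
  exact_mod_cast this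

lemma chainLength_le {A : Set AdditionChain} {c : AdditionChain} (hc : c ∈ A) :
    chainLength A c.target ≤ c.len :=
  Nat.sInf_le ⟨c, hc, rfl, rfl⟩

lemma exists_chain_of_length {A : Set AdditionChain} {c : AdditionChain} (hc : c ∈ A) :
    ∃ c' ∈ A, c'.target = c.target ∧ c'.len = chainLength A c.target :=
  Nat.sInf_mem (s := {r | ∃ c' ∈ A, c'.target = c.target ∧ c'.len = r}) ⟨c.len, c, hc, rfl, rfl⟩

/-- The binary method. -/
lemma isAdmissible_of_append_mem {A : Set AdditionChain} (h1 : AdditionChain.one ∈ A)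
    (happ : ∀ c ∈ A, ∀ i, c.append i ∈ A) : IsAdmissible A := by
  have hshort : ∀ n : ℕ, 1 ≤ n →
      ∃ c ∈ A, c.target = n ∧ (c.len : ℤ) ≤ ⌊Real.logb 2 (n : ℝ)⌋ + (binaryOnes n : ℤ) - 1 := by
    intro n
    simp only [floor_logb_natCast_eq]
    induction n using Nat.strong_induction_on with
    | _ n ih =>
      intro hn
      rcases hn.eq_or_lt with rfl | hn
      · have := binaryOnes_pos one_ne_zero
        refine ⟨_, h1, rfl, ?_⟩
        simp only [Nat.log_one_right, AdditionChain.one]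
        omega
      have hlog : Nat.log 2 n = Nat.log 2 (n / 2) + 1 := Nat.log_of_one_lt_of_le one_lt_two hn
      obtain ⟨c, hc, ht, hl⟩ := ih (n / 2) (by omega) (by omega)
      have hdouble : (c.append (Fin.last _)).target = 2 * (n / 2) := by
        rw [c.append_target, ← ht, two_mul]
        rfl
      obtain ⟨k, rfl | rfl⟩ := Nat.even_or_odd' n
      · rw [Nat.mul_div_cancel_left _ two_pos] at hl hlog hdouble
        refine ⟨_, happ c hc (Fin.last _), hdouble, ?_⟩
        rw [c.append_len, hlog, binaryOnes_two_mul]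
        push_cast
        omega
      · rw [show (2 * k + 1) / 2 = k by omega] at hl hlog hdouble
        refine ⟨_, happ _ (happ c hc (Fin.last _)) 0, ?_, ?_⟩
        · rw [AdditionChain.append_target, hdouble, AdditionChain.seq_zero]
        · rw [AdditionChain.append_len, c.append_len, hlog, binaryOnes_two_mul_add_one]
          push_cast
          omega
  refine ⟨hshort, fun n hn => ?_⟩
  obtain ⟨c, hc, rfl, -⟩ := hshort n hn
  obtain ⟨c', hc', ht, hl⟩ := exists_chain_of_length hc
  have := chainLength_le (happ c' hc' (Fin.last _))
  rw [c'.append_target, c'.append_len] at this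
  rw [← hl, two_mul, ← ht]
  exact this

lemma isAdmissible_univ : IsAdmissible Set.univ :=
  isAdmissible_of_append_mem trivial fun _ _ _ => trivial

lemma isAdmissible_starChains : IsAdmissible starChains :=
  isAdmissible_of_append_mem (fun k => k.elim0) fun _ hc i => AdditionChain.append_mem_starChains hc i

lemma IsAdmissible.exists_chain {A : Set AdditionChain} (hA : IsAdmissible A) {n : ℕ} (hn : 1 ≤ n) :
    ∃ c ∈ A, c.target = n ∧ c.len = chainLength A n := by
  obtain ⟨c, hc, rfl, -⟩ := hA.exists_short n hn
  exact exists_chain_of_length hc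

lemma IsAdmissible.chainLength_le {A : Set AdditionChain} (hA : IsAdmissible A) {n : ℕ}
    (hn : 1 ≤ n) : chainLength A n + 1 ≤ Nat.log 2 n + binaryOnes n := by
  obtain ⟨c, hc, rfl, h⟩ := hA.exists_short n hn
  rw [floor_logb_natCast_eq] at h
  have := _root_.chainLength_le hc
  omega

lemma IsAdmissible.log_le_chainLength {A : Set AdditionChain} (hA : IsAdmissible A) {n : ℕ}
    (hn : 1 ≤ n) : Nat.log 2 n ≤ chainLength A n := by
  obtain ⟨c, -, rfl, h⟩ := hA.exists_chain hn
  rw [← h, ← Nat.log_pow one_lt_two c.len]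
  exact Nat.log_mono_right c.target_le_two_pow

/-- Numbers of bounded defect have boundedly many binary ones. -/
lemma IsAdmissible.exists_binaryOnes_le {A : Set AdditionChain} (hA : IsAdmissible A) (R : ℝ) :
    ∃ K : ℕ, ∀ n : ℕ, 1 ≤ n → defect A n ≤ R → binaryOnes n ≤ K := by
  -- F is so large that F non-doubling steps already force a defect above R.
  obtain ⟨F, hF⟩ := exists_pow_lt_of_lt_one (y := (5 / 6 : ℝ))
    (show (0 : ℝ) < (2 ^ R * (4 / 3))⁻¹ by positivity) (by norm_num)
  refine ⟨2 ^ F, fun n hn hR => ?_⟩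
  obtain ⟨c, -, rfl, hl⟩ := hA.exists_chain hn
  obtain ⟨f, hf, hle⟩ := c.exists_target_bound
  refine hf.trans (Nat.pow_le_pow_right two_pos ?_)
  by_contra! hlt
  have hpos : (0 : ℝ) < c.target := by exact_mod_cast hn
  have h1 : (2 : ℝ) ^ c.len ≤ 2 ^ R * c.target := by
    rw [defect, ← hl, sub_le_iff_le_add] at hR
    calc (2 : ℝ) ^ c.len = 2 ^ (c.len : ℝ) := (Real.rpow_natCast _ _).symm
      _ ≤ 2 ^ (R + Real.logb 2 c.target) := Real.rpow_le_rpow_of_exponent_le one_le_two hR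
      _ = _ := by rw [Real.rpow_add two_pos, Real.rpow_logb two_pos (by norm_num) hpos]
  have h2 : (5 / 6 : ℝ) ^ f ≤ (5 / 6) ^ F :=
    pow_le_pow_of_le_one (by norm_num) (by norm_num) hlt.le
  have h3 : (5 / 6 : ℝ) ^ f * (2 ^ R * (4 / 3)) < 1 := by
    have := h2.trans_lt hF
    rwa [← one_div, lt_div_iff₀ (by positivity)] at this
  have h4 : (c.target : ℝ) ≤ c.target * ((5 / 6 : ℝ) ^ f * (2 ^ R * (4 / 3))) := by
    calc (c.target : ℝ) ≤ 2 ^ c.len * (5 / 6) ^ f * (4 / 3) := hle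
      _ ≤ 2 ^ R * c.target * (5 / 6) ^ f * (4 / 3) := by gcongr
      _ = _ := by ring
  nlinarith

/-- The quantity ℓ(2^k n) - k is a natural number and does not increase with k; it is constant from
a minimizing k on. -/
lemma IsAdmissible.exists_stable_two_pow_mul {A : Set AdditionChain} (hA : IsAdmissible A) {n : ℕ}
    (hn : 1 ≤ n) : ∃ k, IsStable A (2 ^ k * n) := by
  have hpos : ∀ k, 1 ≤ 2 ^ k * n := fun k => Nat.mul_pos (by positivity) hn
  have hle : ∀ k, k ≤ chainLength A (2 ^ k * n) := by
    intro k
    refine le_trans ?_ (hA.log_le_chainLength (hpos k))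
    exact Nat.le_log_of_pow_le one_lt_two (Nat.le_mul_of_pos_right _ hn)
  have hstep : ∀ k i, chainLength A (2 ^ (k + i) * n) ≤ chainLength A (2 ^ k * n) + i := by
    intro k i
    induction i with
    | zero => simp
    | succ i ih =>
      have := hA.length_double _ (hpos (k + i))
      rw [← add_assoc, pow_succ', mul_assoc]
      omega
  let g : ℕ → ℕ := fun k => chainLength A (2 ^ k * n) - k
  obtain ⟨k, hk⟩ : ∃ k, ∀ i, g k ≤ g i := by
    obtain ⟨_, ⟨k, rfl⟩, hk⟩ :=
      WellFounded.has_min (wellFounded_lt (α := ℕ)) (Set.range g) ⟨_, 0, rfl⟩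
    exact ⟨k, fun i => not_lt.1 (hk _ ⟨i, rfl⟩)⟩
  refine ⟨k, fun i => ?_⟩
  rw [← mul_assoc, ← pow_add, add_comm i k]
  have h1 := hk (k + i)
  have h2 := hstep k i
  have h3 := hle k
  have h4 := hle (k + i)
  simp only [g] at h1
  omega

lemma IsAdmissible.exists_defect_eq {A : Set AdditionChain} (hA : IsAdmissible A) (k : ℕ)
    {a t : ℕ} (ht : t < 2 ^ a) : ∃ j ≤ binaryOnes t,
      defect A (2 ^ k * (2 ^ a + t)) = j + -Real.logb 2 (1 + t / 2 ^ a) := by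
  have hn : 1 ≤ 2 ^ k * (2 ^ a + t) := Nat.mul_pos (by positivity) (by positivity)
  have hlog : Nat.log 2 (2 ^ k * (2 ^ a + t)) = k + a := by
    refine Nat.log_eq_of_pow_le_of_lt_pow ?_ ?_
    · rw [pow_add]
      gcongr
      omega
    · rw [pow_succ, pow_add, mul_assoc]
      gcongr
      omega
  have hones : binaryOnes (2 ^ k * (2 ^ a + t)) = binaryOnes t + 1 := by
    rw [← binaryOnes_two_pow_add ht]
    clear hn hlog
    induction k with
    | zero => simp
    | succ k ih => rw [pow_succ', mul_assoc, binaryOnes_two_mul, ih]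
  have h1 := hA.chainLength_le hn
  have h2 := hA.log_le_chainLength hn
  rw [hlog] at h1 h2
  obtain ⟨j, hj⟩ := Nat.exists_eq_add_of_le h2
  refine ⟨j, by omega, ?_⟩
  rw [defect, hj, logb_two_pow_mul_add]
  push_cast
  ring

/-! ### Order structure of the defect sets. -/

lemma IsAdmissible.defectSet_inter_Iic_subset {A : Set AdditionChain} (hA : IsAdmissible A)
    (R : ℝ) : ∃ K : ℕ, defectSet A ∩ Set.Iic R ⊆
      ⋃ j < K, (fun e : ℝ => (j : ℝ) + e) '' sparseNegLogs K := by
  obtain ⟨K, hK⟩ := hA.exists_binaryOnes_le R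
  refine ⟨K, ?_⟩
  rintro _ ⟨⟨n, hn, rfl⟩, hR⟩
  have hones := hK n hn hR
  obtain ⟨t, ht, h⟩ := exists_two_pow_add (n := n) (by omega)
  obtain ⟨j, hj, hdef⟩ := hA.exists_defect_eq 0 ht
  rw [pow_zero, one_mul, ← h] at hdef
  rw [h, binaryOnes_two_pow_add ht] at hones
  simp only [Set.mem_iUnion]
  exact ⟨j, by omega, _, ⟨_, ⟨_, t, ht, by omega, rfl⟩, rfl⟩, hdef.symm⟩

lemma IsAdmissible.containsOmegaPow_stableDefectSet {A : Set AdditionChain} (hA : IsAdmissible A)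
    (m : ℕ) : ContainsOmegaPow m (stableDefectSet A) := by
  have hcover : sparseNegLogs m ⊆ ⋃ j < m + 1, {e : ℝ | (j : ℝ) + e ∈ stableDefectSet A} := by
    rintro _ ⟨_, ⟨a, t, ht, hm, rfl⟩, rfl⟩
    obtain ⟨k, hk⟩ := hA.exists_stable_two_pow_mul (n := 2 ^ a + t)
      (Nat.one_le_two_pow.trans (Nat.le_add_right _ _))
    obtain ⟨j, hj, hdef⟩ := hA.exists_defect_eq k ht
    simp only [Set.mem_iUnion]
    exact ⟨j, by omega, _, Nat.mul_pos (by positivity) (by positivity), hk, hdef⟩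
  obtain ⟨j, -, h⟩ := ((containsOmegaPow_sparseNegLogs m).mono hcover).of_iUnion_lt
  exact h.map (g := fun e => (j : ℝ) + e) (fun x _ y _ hxy => by simpa using hxy) fun e he => he

lemma stableDefectSet_subset (A : Set AdditionChain) : stableDefectSet A ⊆ defectSet A := by
  rintro x ⟨n, hn, -, h⟩
  exact ⟨n, hn, h⟩

lemma isWF_biUnion_lt {k : ℕ} {s : ℕ → Set ℝ} (h : ∀ j, (s j).IsWF) : (⋃ j < k, s j).IsWF := by
  induction k with
  | zero => simp
  | succ k ih =>
    rw [Set.biUnion_lt_succ]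
    exact ih.union (h k)

lemma IsAdmissible.isWF_defectSet {A : Set AdditionChain} (hA : IsAdmissible A) :
    (defectSet A).IsWF := by
  have hpart : ∀ R, (defectSet A ∩ Set.Iic R).IsWF := by
    intro R
    obtain ⟨K, hK⟩ := hA.defectSet_inter_Iic_subset R
    refine Set.IsWF.mono (isWF_biUnion_lt fun j => ?_) hK
    exact ((isWF_sparseNegLogs K).isPWO.image_of_monotone fun x y hxy => by simpa using hxy).isWF
  -- A descending sequence stays below its first term, so bounded parts suffice.
  rw [Set.isWF_iff_no_descending_seq]
  intro f hf hmem
  refine Set.isWF_iff_no_descending_seq.1 (hpart (f 0)) f hf ?_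
  exact fun n => ⟨hmem n, hf.antitone (Nat.zero_le n)⟩

lemma IsAdmissible.exists_not_containsOmegaPow {A : Set AdditionChain} (hA : IsAdmissible A)
    (R : ℝ) : ∃ m, ¬ ContainsOmegaPow m (defectSet A ∩ Set.Iio R) := by
  obtain ⟨K, hK⟩ := hA.defectSet_inter_Iic_subset R
  refine ⟨2 * K + 1, fun h => ?_⟩
  obtain ⟨j, -, hj⟩ := (h.mono ((Set.inter_subset_inter_right _
    Set.Iio_subset_Iic_self).trans hK)).of_iUnion_lt
  refine not_containsOmegaPow_sparseNegLogs K (hj.map (g := fun x : ℝ => x - (j : ℝ)) ?_ ?_)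
  · exact fun x _ y _ hxy => by simpa using hxy
  · rintro _ ⟨e, he, rfl⟩
    simpa using he

lemma IsAdmissible.isWellOrderedOfType_of_subset {A : Set AdditionChain} (hA : IsAdmissible A)
    {S : Set ℝ} (h1 : stableDefectSet A ⊆ S) (h2 : S ⊆ defectSet A) :
    IsWellOrderedOfType S (ω ^ ω) := by
  refine isWellOrderedOfType_omega_opow_omega (hA.isWF_defectSet.mono h2) (fun x _ => ?_)
    fun m => (hA.containsOmegaPow_stableDefectSet m).mono h1
  obtain ⟨m, hm⟩ := hA.exists_not_containsOmegaPow x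
  exact ⟨m, fun h => hm (h.mono (Set.inter_subset_inter_left _ h2))⟩

theorem mainTheorem1 :
    (∀ A : Set AdditionChain, IsAdmissible A →
      IsWellOrderedOfType (defectSet A) (ω ^ ω) ∧
      IsWellOrderedOfType (stableDefectSet A) (ω ^ ω)) ∧
    (IsAdmissible Set.univ ∧ IsAdmissible starChains) ∧
    (IsWellOrderedOfType (defectSet Set.univ) (ω ^ ω) ∧
      IsWellOrderedOfType (defectSet starChains) (ω ^ ω) ∧
      IsWellOrderedOfType (stableDefectSet Set.univ) (ω ^ ω) ∧
      IsWellOrderedOfType (stableDefectSet starChains) (ω ^ ω)) := by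
  have h : ∀ A : Set AdditionChain, IsAdmissible A →
      IsWellOrderedOfType (defectSet A) (ω ^ ω) ∧
      IsWellOrderedOfType (stableDefectSet A) (ω ^ ω) := fun A hA =>
    ⟨hA.isWellOrderedOfType_of_subset (stableDefectSet_subset A) le_rfl,
      hA.isWellOrderedOfType_of_subset le_rfl (stableDefectSet_subset A)⟩
  have hu := h _ isAdmissible_univ
  have hs := h _ isAdmissible_starChains
  exact ⟨h, ⟨isAdmissible_univ, isAdmissible_starChains⟩, hu.1, hs.1, hu.2, hs.2⟩
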